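/- Let $G$ be a countable discrete abelian group. An operation is a tuple $e=(\gamma_e,s_{e,0},\dots,s_{e,\gamma_e-1},g_{e,0},\dots,g_{e,\gamma_e-1})$ with an integer $\gamma_e>1$, $s_{e,i}\in\mathbb N_0$ and $g_{e,i}\in G$. Let $F$ be a sequence of operations, $F(n)=(\gamma_n,s(n,0),\dots,s(n,\gamma_n-1),g(n,0),\dots,g(n,\gamma_n-1))$, $n\in\mathbb N_0$, such that for all $n,d\in\mathbb N_0$ there are infinitely many $m$ with $F(n+i)=F(m+i)$ for all $0\le i<d$. Construct columns (finite sequences of disjoint intervals of equal length, called levels) $C_{N,g}$ for $N\in\mathbb N_0$, $g\in G$ as follows. The columns $C_{0,g}$, $g\in G$, consist each of one interval of length $1$, and these intervals are disjoint. Given the columns $C_{N,g}$, cut every level of every $C_{N,g}$ into $\gamma_N$ subintervals of equal length, numbered $0,\dots,\gamma_N-1$ from left to right, and let $C_{N,g,i}$ be the sequence of the $i$-th subintervals of the levels of $C_{N,g}$, in the same order. Then $C_{N+1,g}$ consists, from bottom to top, of $C_{N,g+g(N,0),0}$, then $s(N,0)$ spacers, then $C_{N,g+g(N,1),1}$, then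 $s(N,1)$ spacers, and so on up to $C_{N,g+g(N,\gamma_N-1),\gamma_N-1}$ and then $s(N,\gamma_N-1)$ spacers, where the spacers are new intervals, disjoint from each other and from everything used before, of the same length as the subintervals. Let $X$ be the union of all levels of all columns, with Lebesgue measure $\mu$, and let $T$ be the transformation, defined $\mu$-almost everywhere on $X$, that maps each level of a column other than the top one by translation onto the level just above it. Then $T$ is multiply recurrent: for every measurable set $A\subseteq X$ with $\mu(A)>0$ and every integer $d>0$ there is an integer $n>0$ with $$\mu\bigl(A\cap T^nA\cap T^{2n}A\cap\dots\cap T^{dn}A\bigr)>0 .$$ This includes the case where $G$ is infinite, in which $\mu(X)=\infty$. -/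

import Mathlib

open MeasureTheory

namespace CutStack

/-- An operation that leads from one generation of columns to the next: cut every level into
`γ > 1` pieces, put `s k` spacers above the `k`-th piece, and let `g k` describe the change of the
`G`-component. -/
structure Operation (G : Type*) where
  γ : ℕ
  one_lt : 1 < γ
  s : Fin γ → ℕ
  g : Fin γ → G

/-- Every finite block of consecutive values of `F` occurs in `F` at infinitely many places. -/
def Admissible {G : Type*} (F : ℕ → Operation G) : Prop :=
  ∀ n d : ℕ, {m : ℕ | ∀ i < d, F (n + i) = F (m + i)}.Infinite

section Construction

variable {G : Type*} [AddCommGroup G] (F : ℕ → Operation G)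

/-- The length of the levels of generation `N`. -/
noncomputable def width (N : ℕ) : ℝ := ∏ n ∈ Finset.range N, ((F n).γ : ℝ)⁻¹

/-- The total length of one column of generation `N`. -/
noncomputable def mass : ℕ → ℝ
  | 0 => 1
  | N + 1 => mass N + ((∑ k, (F N).s k : ℕ) : ℝ) * width F (N + 1)

/-- The intervals live on `G × ℝ`, a disjoint union of copies of the line, one for each `g : G`.
The pair `I = (g, a)` encodes the generation-`N` interval `{g} × [a, a + width F N)`. -/
def level (N : ℕ) (I : G × ℝ) : Set (G × ℝ) :=
  {I.1} ×ˢ Set.Ico I.2 (I.2 + width F N)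

/-- The `k`-th of the `γ` pieces, from left to right, into which the generation-`N` interval `I`
is cut. -/
noncomputable def piece (N : ℕ) (k : Fin (F N).γ) (I : G × ℝ) : G × ℝ :=
  (I.1, I.2 + (k : ℕ) * width F (N + 1))

/-- The `j`-th spacer above the `k`-th subcolumn of the generation-`(N + 1)` column with index `g`.
The levels of generation `N` fill `G × [0, mass F N)`; the spacers of the column with
index `g` are placed next to each other on the line with label `g`, starting at `mass F N`. -/
noncomputable def spacer (N : ℕ) (g : G) (k : Fin (F N).γ) (j : ℕ) : G × ℝ :=
  (g, mass F N + (((∑ l ∈ Finset.univ.filter (· < k), (F N).s l) + j : ℕ) : ℝ) * width F (N + 1))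

/-- The column of generation `N` with index `g`, as the list of its levels from bottom to top. -/
noncomputable def column : ℕ → G → List (G × ℝ)
  | 0, g => [(g, 0)]
  | N + 1, g => (List.finRange (F N).γ).flatMap fun k =>
      (column N (g + (F N).g k)).map (piece F N k) ++
        (List.range ((F N).s k)).map (spacer F N g k)

/-- The space on which the transformation lives: the union of all levels of all columns. -/
def space : Set (G × ℝ) :=
  ⋃ (N : ℕ) (g : G), ⋃ I ∈ column F N g, level F N I

/-- Lebesgue measure on the union of all levels. -/
noncomputable def measure [MeasurableSpace G] : Measure (G × ℝ) :=
  ((Measure.count : Measure G).prod volume).restrict (space F)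

/-- `Step F x y`: in some column, `x` lies in a level `I` that is not the top level, and the
translation of `I` onto the level `J` just above it sends `x` to `y`. -/
def Step (x y : G × ℝ) : Prop :=
  ∃ (N : ℕ) (g : G) (I J : G × ℝ), [I, J] <:+: column F N g ∧
    x ∈ level F N I ∧ y = (J.1, x.2 + (J.2 - I.2))

open Classical in
/-- The transformation: the limit of the translations of levels. The points of the space where it
is not determined by any column form a null set; they are left fixed. -/
noncomputable def transformation (x : G × ℝ) : G × ℝ :=
  if h : ∃ y, Step F x y then h.choose else x

end Construction

/-- `T` is `d`-recurrent. -/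
def IsRecurrent {X : Type*} [MeasurableSpace X] (μ : Measure X) (T : X → X) (d : ℕ) : Prop :=
  ∀ A : Set X, MeasurableSet A → 0 < μ A →
    ∃ n : ℕ, 0 < n ∧ 0 < μ (⋂ j ∈ Finset.range (d + 1), T^[j * n] '' A)

def MultiplyRecurrent {X : Type*} [MeasurableSpace X] (μ : Measure X) (T : X → X) : Prop :=
  ∀ d : ℕ, 0 < d → IsRecurrent μ T d

/-! The translations of levels are consistent, so that the transformation is well defined. -/

section WellDefined

variable {G : Type*} [AddCommGroup G] (F : ℕ → Operation G)

theorem width_pos (N : ℕ) : 0 < width F N :=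
  Finset.prod_pos fun n _ => inv_pos.2 (by have := (F n).one_lt; positivity)

theorem width_succ (N : ℕ) : ((F N).γ : ℝ) * width F (N + 1) = width F N := by
  have : ((F N).γ : ℝ) ≠ 0 := by have := (F N).one_lt; positivity
  rw [width, width, Finset.prod_range_succ]
  field_simp

theorem piece_subset (N : ℕ) (k : Fin (F N).γ) (I : G × ℝ) :
    level F (N + 1) (piece F N k I) ⊆ level F N I := by
  rintro ⟨a, t⟩ ⟨h1, h2, h3⟩
  have hw := width_pos F (N + 1)
  have hk : ((k : ℕ) : ℝ) + 1 ≤ (F N).γ := by exact_mod_cast k.2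
  have := width_succ F N
  simp only [piece] at h1 h2 h3
  refine ⟨h1, ?_, ?_⟩
  · have : 0 ≤ ((k : ℕ) : ℝ) * width F (N + 1) := by positivity
    simp only; linarith
  · simp only; nlinarith

theorem exists_piece (N : ℕ) (I x : G × ℝ) (hx : x ∈ level F N I) :
    ∃ k, x ∈ level F (N + 1) (piece F N k I) := by
  obtain ⟨h1, h2, h3⟩ := hx
  have hw := width_pos F (N + 1)
  have hs := width_succ F N
  have h0 : 0 ≤ (x.2 - I.2) / width F (N + 1) := div_nonneg (by linarith) hw.le
  have hlt : (x.2 - I.2) / width F (N + 1) < (F N).γ := by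
    rw [div_lt_iff₀ hw]; linarith
  have ha := Nat.floor_le h0
  have hb := Nat.lt_floor_add_one ((x.2 - I.2) / width F (N + 1))
  rw [le_div_iff₀ hw] at ha
  rw [div_lt_iff₀ hw] at hb
  refine ⟨⟨⌊(x.2 - I.2) / width F (N + 1)⌋₊, (Nat.floor_lt h0).2 hlt⟩, h1, ?_, ?_⟩ <;>
    simp only [piece] <;> linarith

theorem piece_disjoint (N : ℕ) (k l : Fin (F N).γ) (I x : G × ℝ)
    (hk : x ∈ level F (N + 1) (piece F N k I)) (hl : x ∈ level F (N + 1) (piece F N l I)) :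
    k = l := by
  obtain ⟨-, h2, h3⟩ := hk
  obtain ⟨-, h4, h5⟩ := hl
  have hw := width_pos F (N + 1)
  simp only [piece] at h2 h3 h4 h5
  have a : ((k : ℕ) : ℝ) < (l : ℕ) + 1 := by by_contra! h; nlinarith
  have b : ((l : ℕ) : ℝ) < (k : ℕ) + 1 := by by_contra! h; nlinarith
  have a' : (k : ℕ) < l + 1 := by exact_mod_cast a
  have b' : (l : ℕ) < k + 1 := by exact_mod_cast b
  ext; omega

theorem spacer_disjoint (N : ℕ) (g g' : G) (k l : Fin (F N).γ) (i j : ℕ) (x : G × ℝ)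
    (hi : i < (F N).s k) (hj : j < (F N).s l)
    (hk : x ∈ level F (N + 1) (spacer F N g k i)) (hl : x ∈ level F (N + 1) (spacer F N g' l j)) :
    g = g' ∧ k = l ∧ i = j := by
  obtain ⟨h1, h2, h3⟩ := hk
  obtain ⟨h1', h4, h5⟩ := hl
  have hw := width_pos F (N + 1)
  simp only [spacer] at h1 h1' h2 h3 h4 h5
  have hg : g = g' := by rw [← h1.symm.trans h1']
  set p := ∑ l ∈ Finset.univ.filter (· < k), (F N).s l with hp
  set q := ∑ m ∈ Finset.univ.filter (· < l), (F N).s m with hq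
  have a : ((p + i : ℕ) : ℝ) < (q + j : ℕ) + 1 := by by_contra! h; nlinarith
  have b : ((q + j : ℕ) : ℝ) < (p + i : ℕ) + 1 := by by_contra! h; nlinarith
  have a' : p + i < q + j + 1 := by exact_mod_cast a
  have b' : q + j < p + i + 1 := by exact_mod_cast b
  have key : ∀ u v : Fin (F N).γ, u < v →
      (∑ l ∈ Finset.univ.filter (· < u), (F N).s l) + (F N).s u
        ≤ ∑ l ∈ Finset.univ.filter (· < v), (F N).s l := by
    intro u v huv
    rw [add_comm, ← Finset.sum_insert (by simp)]
    apply Finset.sum_le_sum_of_subset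
    intro z hz
    simp only [Finset.mem_insert, Finset.mem_filter, Finset.mem_univ, true_and] at hz ⊢
    rcases hz with rfl | hz
    · exact huv
    · exact hz.trans huv
  rcases lt_trichotomy k l with h | h | h
  · have := key _ _ h; omega
  · subst h; exact ⟨hg, rfl, by omega⟩
  · have := key _ _ h; omega

theorem mem_column_succ {N : ℕ} {g : G} {K : G × ℝ} :
    K ∈ column F (N + 1) g ↔ ∃ k, (∃ I ∈ column F N (g + (F N).g k), piece F N k I = K) ∨
      ∃ j < (F N).s k, spacer F N g k j = K := by
  simp [column]

theorem level_lt_mass : ∀ (N : ℕ) (g : G), ∀ I ∈ column F N g, ∀ x ∈ level F N I, x.2 < mass F N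
  | 0, g, I, hI, x, hx => by
      simp only [column, List.mem_singleton] at hI
      subst hI
      simpa [level, width, mass] using hx.2.2
  | N + 1, g, K, hK, x, hx => by
      have hw := width_pos F (N + 1)
      obtain ⟨k, ⟨I, hI, rfl⟩ | ⟨j, hj, rfl⟩⟩ := (mem_column_succ F).1 hK
      · have h := level_lt_mass N _ I hI x (piece_subset F N k I hx)
        have : 0 ≤ ((∑ k, (F N).s k : ℕ) : ℝ) * width F (N + 1) := by positivity
        simp only [mass]; linarith
      · have h := hx.2.2
        have hle : (∑ l ∈ Finset.univ.filter (· < k), (F N).s l) + j + 1 ≤ ∑ k, (F N).s k := by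
          calc _ ≤ (∑ l ∈ Finset.univ.filter (· < k), (F N).s l) + (F N).s k := by omega
            _ = ∑ l ∈ insert k (Finset.univ.filter (· < k)), (F N).s l := by
                rw [Finset.sum_insert (by simp), add_comm]
            _ ≤ _ := Finset.sum_le_sum_of_subset (Finset.subset_univ _)
        have hle' : (((∑ l ∈ Finset.univ.filter (· < k), (F N).s l) + j : ℕ) : ℝ) + 1
            ≤ ((∑ k, (F N).s k : ℕ) : ℝ) := by exact_mod_cast hle
        simp only [spacer] at h
        simp only [mass]; nlinarith

theorem piece_spacer_disjoint {N : ℕ} {g g' : G} {k l : Fin (F N).γ} {j : ℕ} {I x : G × ℝ}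
    (hI : I ∈ column F N g) (hx : x ∈ level F (N + 1) (piece F N k I))
    (hx' : x ∈ level F (N + 1) (spacer F N g' l j)) : False := by
  have h1 := level_lt_mass F N g I hI x (piece_subset F N k I hx)
  have h2 := hx'.2.1
  have hw := width_pos F (N + 1)
  simp only [spacer] at h2
  have : 0 ≤ (((∑ m ∈ Finset.univ.filter (· < l), (F N).s m) + j : ℕ) : ℝ) * width F (N + 1) := by
    positivity
  linarith

/-- Distinct levels of the same generation are disjoint. -/
theorem level_unique : ∀ (N : ℕ) (g g' : G), ∀ I ∈ column F N g, ∀ I' ∈ column F N g',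
    ∀ x, x ∈ level F N I → x ∈ level F N I' → g = g' ∧ I = I'
  | 0, g, g', I, hI, I', hI', x, hx, hx' => by
      simp only [column, List.mem_singleton] at hI hI'
      subst hI hI'
      have h : g = g' := hx.1.symm.trans hx'.1
      exact ⟨h, by rw [h]⟩
  | N + 1, g, g', K, hK, K', hK', x, hx, hx' => by
      obtain ⟨k, ⟨I, hI, rfl⟩ | ⟨j, hj, rfl⟩⟩ := (mem_column_succ F).1 hK <;>
        obtain ⟨k', ⟨I', hI', rfl⟩ | ⟨j', hj', rfl⟩⟩ := (mem_column_succ F).1 hK'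
      · obtain ⟨h1, rfl⟩ := level_unique N _ _ I hI I' hI' x (piece_subset F N k I hx)
          (piece_subset F N k' I' hx')
        obtain rfl := piece_disjoint F N k k' I x hx hx'
        exact ⟨add_right_cancel h1, rfl⟩
      · exact (piece_spacer_disjoint F hI hx hx').elim
      · exact (piece_spacer_disjoint F hI' hx' hx).elim
      · obtain ⟨rfl, rfl, rfl⟩ := spacer_disjoint F N g g' k k' j j' x hj hj' hx hx'
        exact ⟨rfl, rfl⟩

theorem level_nonempty (N : ℕ) (I : G × ℝ) : I ∈ level F N I :=
  ⟨rfl, le_rfl, by have := width_pos F N; simpa using this⟩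

theorem piece_inj {N : ℕ} {k : Fin (F N).γ} {I J : G × ℝ} (h : piece F N k I = piece F N k J) :
    I = J := by
  simp only [piece, Prod.mk.injEq] at h
  exact Prod.ext h.1 (by linarith [h.2])

theorem column_nodup : ∀ (N : ℕ) (g : G), (column F N g).Nodup
  | 0, g => by simp [column]
  | N + 1, g => by
      rw [column, List.nodup_flatMap]
      constructor
      · intro k _
        refine List.nodup_append.2 ⟨(column_nodup N _).map fun I J h => piece_inj F h, ?_, ?_⟩
        · refine List.Nodup.map_on ?_ List.nodup_range
          intro i hi j hj h
          exact (spacer_disjoint F N g g k k i j _ (List.mem_range.1 hi) (List.mem_range.1 hj)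
            (level_nonempty F _ _) (h ▸ level_nonempty F _ _)).2.2
        · intro K hK K' hK' h
          obtain ⟨I, hI, rfl⟩ := List.mem_map.1 hK
          obtain ⟨j, hj, rfl⟩ := List.mem_map.1 hK'
          exact piece_spacer_disjoint F hI (level_nonempty F _ _)
            (by rw [← h]; exact level_nonempty F _ _)
      · refine (List.nodup_finRange _).imp ?_
        intro k l hkl K hK hK'
        rcases List.mem_append.1 hK with hK | hK <;> rcases List.mem_append.1 hK' with hK' | hK'
        · obtain ⟨I, hI, rfl⟩ := List.mem_map.1 hK
          obtain ⟨J, hJ, h⟩ := List.mem_map.1 hK'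
          have hx := level_nonempty F (N + 1) (piece F N k I)
          have hx' : piece F N k I ∈ level F (N + 1) (piece F N l J) := h ▸ hx
          obtain ⟨-, rfl⟩ := level_unique F N _ _ I hI J hJ _ (piece_subset F N k I hx)
            (piece_subset F N l J hx')
          exact hkl (piece_disjoint F N k l I _ hx hx')
        · obtain ⟨I, hI, rfl⟩ := List.mem_map.1 hK
          obtain ⟨j, hj, h⟩ := List.mem_map.1 hK'
          exact piece_spacer_disjoint F hI (level_nonempty F _ _)
            (by rw [h]; exact level_nonempty F _ _)
        · obtain ⟨I, hI, rfl⟩ := List.mem_map.1 hK'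
          obtain ⟨j, hj, h⟩ := List.mem_map.1 hK
          exact piece_spacer_disjoint F hI (level_nonempty F _ _)
            (by rw [h]; exact level_nonempty F _ _)
        · obtain ⟨i, hi, rfl⟩ := List.mem_map.1 hK
          obtain ⟨j, hj, h⟩ := List.mem_map.1 hK'
          exact hkl (spacer_disjoint F N g g k l i j _ (List.mem_range.1 hi) (List.mem_range.1 hj)
            (level_nonempty F _ _) (h ▸ level_nonempty F _ _)).2.1

/-- The translations of one generation extend those of the previous one. -/
theorem step_succ {N : ℕ} {g : G} {I J x : G × ℝ} (h : [I, J] <:+: column F N g)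
    (hx : x ∈ level F N I) : ∃ (g' : G) (I' J' : G × ℝ), [I', J'] <:+: column F (N + 1) g' ∧
      x ∈ level F (N + 1) I' ∧ J'.1 = J.1 ∧ J'.2 - I'.2 = J.2 - I.2 := by
  obtain ⟨k, hk⟩ := exists_piece F N I x hx
  refine ⟨g - (F N).g k, piece F N k I, piece F N k J, ?_, hk, rfl, by simp [piece]⟩
  obtain ⟨a, b, hab⟩ := List.append_of_mem (List.mem_finRange k)
  rw [column, hab, List.flatMap_append, List.flatMap_cons, sub_add_cancel]
  refine List.IsInfix.trans (h.map (piece F N k)) ?_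
  exact ⟨_, _, by simp only [List.append_assoc]; rfl⟩

theorem step_add {N : ℕ} {g : G} {I J x : G × ℝ} (h : [I, J] <:+: column F N g)
    (hx : x ∈ level F N I) (m : ℕ) : ∃ (g' : G) (I' J' : G × ℝ),
      [I', J'] <:+: column F (N + m) g' ∧
      x ∈ level F (N + m) I' ∧ J'.1 = J.1 ∧ J'.2 - I'.2 = J.2 - I.2 := by
  induction m with
  | zero => exact ⟨g, I, J, h, hx, rfl, rfl⟩
  | succ m ih =>
      obtain ⟨g', I', J', h1, h2, h3, h4⟩ := ih
      obtain ⟨g'', I'', J'', k1, k2, k3, k4⟩ := step_succ F h1 h2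
      exact ⟨g'', I'', J'', k1, k2, k3.trans h3, k4.trans h4⟩

theorem infix_unique {α : Type*} {L : List α} (hL : L.Nodup) {a b c : α}
    (h : [a, b] <:+: L) (h' : [a, c] <:+: L) : b = c := by
  obtain ⟨s, t, rfl⟩ := h
  obtain ⟨s', t', h⟩ := h'
  have e : s' ++ a :: (c :: t') = s ++ a :: (b :: t) := by simpa using h
  have hn : (s ++ a :: (b :: t)).Nodup := by simpa using hL
  have hn' : (s' ++ a :: (c :: t')).Nodup := e ▸ hn
  have h1 : a ∉ s := fun ha => (List.nodup_append.1 hn).2.2 a ha a (by simp) rfl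
  have h2 : a ∉ s' := fun ha => (List.nodup_append.1 hn').2.2 a ha a (by simp) rfl
  rcases List.append_eq_append_iff.1 e with ⟨u, hu, hv⟩ | ⟨u, hu, hv⟩
  · cases u with
    | nil => simp at hv; exact hv.1.symm
    | cons z u => simp at hv; exact (h1 (by rw [hu, hv.1]; simp)).elim
  · cases u with
    | nil => simp at hv; exact hv.1
    | cons z u => simp at hv; exact (h2 (by rw [hu, hv.1]; simp)).elim

theorem step_unique {x y z : G × ℝ} (hy : Step F x y) (hz : Step F x z) : y = z := by
  obtain ⟨N, g, I, J, h1, h2, rfl⟩ := hy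
  obtain ⟨M, g', I', J', h1', h2', rfl⟩ := hz
  obtain ⟨a, K, L, k1, k2, k3, k4⟩ := step_add F h1 h2 M
  obtain ⟨b, K', L', l1, l2, l3, l4⟩ := step_add F h1' h2' N
  rw [add_comm M N] at l1 l2
  obtain ⟨rfl, rfl⟩ := level_unique F _ _ _ K (k1.subset (by simp)) K' (l1.subset (by simp))
    x k2 l2
  obtain rfl := infix_unique (column_nodup F _ _) k1 l1
  rw [← k3, ← l3, ← k4, ← l4]

/-- On a level that is not the top one of its column, the transformation is the translation onto
the level above. -/
theorem transformation_eq {x y : G × ℝ} (h : Step F x y) : transformation F x = y := by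
  have h' : ∃ y, Step F x y := ⟨y, h⟩
  rw [transformation, dif_pos h']
  exact step_unique F h'.choose_spec h

end WellDefined

end CutStack

/-!
Let `Γ` be the product of the first `d` numbers `γ`, and suppose that a stretch of `F` beginning at
generation `p` contains `2 * Γ` disjoint copies of the first `d + 1` operations. Given `j ≤ d`, take
from every level of generation `p` the piece with number `i + (Γ - j)` in the `i`-th of the first
`Γ` copies and with number `i + j` in the `i`-th of the last `Γ` copies. Choosing the piece number
`v` in a copy that begins at generation `q` raises the place in the column by `v * height F q` plus
a number of spacers that, like the change of the index in `G`, depends on `v` only. Raising `v < Γ`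
by `Γ` changes just the last digit, from `0` to `1`, and so adds a constant to both; hence a window
of `Γ` consecutive values of `v` contributes an affine function of its starting point, and the two
opposite shifts by `j` cancel. Only the heights remain, and they are larger in the last `Γ` copies:
the chosen pieces lie in one column, at places that form an arithmetic progression in `j`.

By Lebesgue's density theorem, a set of positive measure almost fills a level of every late
generation, in particular of such a generation `p`. Since the number of pieces depends only on the
stretch, the set then almost fills all the `d + 1` pieces, and a power of the transformation carries
each of them to the next one.
-/

namespace CutStack

open Filter Topology
open scoped ENNReal

theorem getElem?_flatMap_finRange {α : Type*} {n : ℕ} (f : Fin n → List α) (k : Fin n) {i : ℕ}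
    (hi : i < (f k).length) :
    ((List.finRange n).flatMap f)[(∑ l with l < k, (f l).length) + i]? = (f k)[i]? := by
  have hk : (k : ℕ) < (List.finRange n).length := by simp
  have hget : (List.finRange n)[(k : ℕ)] = k := by simp
  have hsplit : List.finRange n =
      (List.finRange n).take k ++ k :: (List.finRange n).drop (k + 1) := by
    conv_lhs => rw [← List.take_append_drop k (List.finRange n), List.drop_eq_getElem_cons hk, hget]
  have hlength : (((List.finRange n).take k).flatMap f).length =
      ∑ l with l < k, (f l).length := by
    rw [List.length_flatMap, List.map_take, ← List.ofFn_eq_map, List.sum_take_ofFn]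
    rfl
  rw [hsplit, List.flatMap_append, List.flatMap_cons,
    List.getElem?_append_right (by rw [hlength]; exact Nat.le_add_right _ _), hlength,
    Nat.add_sub_cancel_left, List.getElem?_append_left hi]

theorem pair_isInfix_of_getElem? {α : Type*} {L : List α} {a b : α} {r : ℕ}
    (ha : L[r]? = some a) (hb : L[r + 1]? = some b) : [a, b] <:+: L := by
  obtain ⟨hr, -⟩ := List.getElem?_eq_some_iff.1 hb
  refine List.infix_iff_getElem?.2 ⟨r, by simp only [List.length_cons, List.length_nil]; omega,
    fun i hi => ?_⟩
  match i, hi with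
  | 0, _ => simpa using ha
  | 1, _ => simpa [add_comm] using hb

theorem sum_range_add_of_quasiperiodic {M : Type*} [AddCancelCommMonoid M] {f : ℕ → M} {Γ : ℕ}
    {c : M} (hf : ∀ x < Γ, f (x + Γ) = f x + c) {j : ℕ} (hj : j ≤ Γ) :
    ∑ u ∈ Finset.range Γ, f (u + j) = ∑ u ∈ Finset.range Γ, f u + j • c := by
  induction j with
  | zero => simp
  | succ j ih =>
    refine add_right_cancel (b := f j) ?_
    calc ∑ u ∈ Finset.range Γ, f (u + (j + 1)) + f j
        = ∑ u ∈ Finset.range Γ, f (u + j) + f (j + Γ) := by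
          simp only [add_comm j Γ, ← Finset.sum_range_succ (fun u => f (u + j)),
            Finset.sum_range_succ' (fun u => f (u + j)), zero_add, add_assoc, add_comm 1 j]
      _ = ∑ u ∈ Finset.range Γ, f u + (j + 1) • c + f j := by
          rw [ih (by omega), hf j (by omega), succ_nsmul]
          abel

theorem ae_eventually_volume_Ico_diff_lt {S : Set ℝ} (hS : MeasurableSet S) {ε : ℝ≥0∞}
    (hε : ε ≠ 0) : ∀ᵐ t, t ∈ S → ∀ᶠ w in 𝓝[>] (0 : ℝ), ∀ a, t ∈ Set.Ico a (a + w) →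
      volume (Set.Ico a (a + w) \ S) < ε * ENNReal.ofReal w := by
  set vitali := IsUnifLocDoublingMeasure.vitaliFamily (volume : Measure ℝ) 1
  filter_upwards [vitali.ae_tendsto_measure_inter_div_of_measurableSet hS.compl] with t hlim ht
  rw [Set.indicator_of_notMem (Set.notMem_compl_iff.2 ht)] at hlim
  obtain ⟨δ, hδ, hsmall⟩ :=
    vitali.eventually_filterAt_iff.1 (hlim.eventually (gt_mem_nhds (pos_iff_ne_zero.2 hε)))
  filter_upwards [Ioo_mem_nhdsGT hδ] with w hw a ha
  have hball : Set.Icc a (a + w) = Metric.closedBall (a + w / 2) (w / 2) := by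
    rw [Real.closedBall_eq_Icc]
    congr 1 <;> ring
  have hmem : Set.Icc a (a + w) ∈ vitali.setsAt t := by
    rw [hball]
    refine IsUnifLocDoublingMeasure.closedBall_mem_vitaliFamily_of_dist_le_mul _ ?_ (half_pos hw.1)
    rw [one_mul, ← Metric.mem_closedBall, ← hball]
    exact Set.Ico_subset_Icc_self ha
  have hsub : Set.Icc a (a + w) ⊆ Metric.closedBall t δ := by
    rw [Real.closedBall_eq_Icc]
    exact Set.Icc_subset_Icc (by linarith [ha.2, hw.2]) (by linarith [ha.1, hw.2])
  have hlt := hsmall _ hmem hsub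
  rw [Real.volume_Icc, add_sub_cancel_left, ENNReal.div_lt_iff (Or.inl (by simpa using hw.1))
    (Or.inl ENNReal.ofReal_ne_top)] at hlt
  refine (measure_mono ?_).trans_lt hlt
  exact fun s hs => ⟨hs.2, Set.Ico_subset_Icc_self hs.1⟩

theorem measure_setOf_forall_add_mem_pos {ι α : Type*} [AddGroup α] [MeasurableSpace α]
    [MeasurableAdd α] (μ : Measure α) [μ.IsAddRightInvariant] {s : Finset ι} {τ : ι → α}
    {J K S : Set α} (hJ : ∀ i ∈ s, ∀ x ∈ J, x + τ i ∈ K) (h : s.card • μ (K \ S) < μ J) :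
    0 < μ {x ∈ J | ∀ i ∈ s, x + τ i ∈ S} := by
  have hcover : J ⊆ {x ∈ J | ∀ i ∈ s, x + τ i ∈ S} ∪ ⋃ i ∈ s, (· + τ i) ⁻¹' (K \ S) := by
    intro x hx
    by_cases hxS : ∀ i ∈ s, x + τ i ∈ S
    · exact Or.inl ⟨hx, hxS⟩
    · push Not at hxS
      obtain ⟨i, hi, hiS⟩ := hxS
      exact Or.inr (Set.mem_iUnion₂.2 ⟨i, hi, hJ i hi x hx, hiS⟩)
  refine pos_iff_ne_zero.2 fun hnull => h.not_ge ?_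
  calc μ J ≤ μ {x ∈ J | ∀ i ∈ s, x + τ i ∈ S} + μ (⋃ i ∈ s, (· + τ i) ⁻¹' (K \ S)) :=
        (measure_mono hcover).trans (measure_union_le _ _)
    _ ≤ ∑ i ∈ s, μ ((· + τ i) ⁻¹' (K \ S)) := by
        rw [hnull, zero_add]
        exact measure_biUnion_finset_le _ _
    _ = s.card • μ (K \ S) := by simp only [measure_preimage_add_right, Finset.sum_const]

instance Operation.neZero_γ {G : Type*} (e : Operation G) : NeZero e.γ :=
  ⟨(zero_lt_one.trans e.one_lt).ne'⟩

/-- The first `L` operations of `F` are repeated from place `q` on. -/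
def PrefixAt {α : Type*} (F : ℕ → α) (L q : ℕ) : Prop :=
  ∀ l < L, F (q + l) = F l

theorem PrefixAt.mono {α : Type*} {F : ℕ → α} {K L q : ℕ} (h : PrefixAt F L q) (hKL : K ≤ L) :
    PrefixAt F K q := fun l hl => h l (hl.trans_le hKL)

theorem PrefixAt.add {α : Type*} {F : ℕ → α} {L M p q : ℕ} (hp : PrefixAt F M p)
    (hq : PrefixAt F L q) (h : q + L ≤ M) : PrefixAt F L (p + q) := fun l hl => by
  rw [add_assoc, hp (q + l) (by omega), hq l hl]

section Recurrence

variable {G : Type*} {F : ℕ → Operation G}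

theorem Admissible.frequently_prefixAt (hF : Admissible F) (L : ℕ) :
    ∃ᶠ q in atTop, PrefixAt F L q := by
  refine (Nat.frequently_atTop_iff_infinite.2 (hF 0 L)).mono fun q hq l hl => ?_
  rw [← hq l hl, zero_add]

theorem Admissible.exists_spaced_prefixAt (hF : Admissible F) (L : ℕ) :
    ∃ q : ℕ → ℕ, ∀ i, PrefixAt F L (q i) ∧ q i + L ≤ q (i + 1) := by
  obtain ⟨φ, hφ, hprefix⟩ := extraction_of_frequently_atTop (hF.frequently_prefixAt L)
  refine ⟨fun i => φ (L * i), fun i => ⟨hprefix _, ?_⟩⟩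
  change φ (L * i) + L ≤ φ (L * (i + 1))
  rw [mul_add_one, add_comm, add_comm (L * i)]
  exact hφ.add_le_nat L (L * i)

end Recurrence

section Counting

variable {G : Type*} (F : ℕ → Operation G)

/-- The number of levels of a column of generation `N`. -/
def height : ℕ → ℕ
  | 0 => 1
  | N + 1 => (F N).γ * height N + ∑ k, (F N).s k

/-- The number of levels of a column of generation `N` that are pieces of spacers, that is, that
do not come from generation `0`. -/
def spacerCount : ℕ → ℕ
  | 0 => 0
  | N + 1 => (F N).γ * spacerCount N + ∑ k, (F N).s k

/-- The number of pieces into which a level of generation `0` is cut up to generation `N`. -/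
def cuts (N : ℕ) : ℕ := ∏ n ∈ Finset.range N, (F n).γ

theorem height_pos (N : ℕ) : 0 < height F N := by
  induction N with
  | zero => exact zero_lt_one
  | succ N ih => exact Nat.add_pos_left (Nat.mul_pos (Nat.pos_of_neZero _) ih) _

theorem height_strictMono : StrictMono (height F) :=
  strictMono_nat_of_lt_succ fun N =>
    (lt_mul_of_one_lt_left (height_pos F N) (F N).one_lt).trans_le (Nat.le_add_right _ _)

theorem cuts_succ (N : ℕ) : cuts F (N + 1) = (F N).γ * cuts F N :=
  (Finset.prod_range_succ _ _).trans (mul_comm _ _)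

theorem cuts_pos (N : ℕ) : 0 < cuts F N :=
  Finset.prod_pos fun _ _ => Nat.pos_of_neZero _

theorem lt_cuts (N : ℕ) : N < cuts F N := by
  refine N.lt_two_pow_self.trans_le ?_
  simpa only [cuts, Finset.prod_const, Finset.card_range] using
    Finset.prod_le_prod' (f := fun _ => 2) (g := fun n => (F n).γ) fun n (_ : n ∈ Finset.range N) =>
      (F n).one_lt

variable {F}

theorem PrefixAt.height_add {L q : ℕ} (h : PrefixAt F L q) :
    height F (q + L) = cuts F L * height F q + spacerCount F L := by
  induction L with
  | zero => simp [cuts, spacerCount]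
  | succ L ih =>
    rw [← add_assoc, height, h L L.lt_succ_self, ih (h.mono L.le_succ), cuts_succ, spacerCount]
    ring

end Counting

section Displacement

variable {G : Type*} [AddCommGroup G]

/-- The number of spacers inserted by the operation `e` below the `k`-th subcolumn. -/
def Operation.spacersBelow (e : Operation G) (k : Fin e.γ) : ℕ := ∑ l with l < k, e.s l

/-- If the operation `e` is applied to columns with `h` levels, then the `k`-th piece of the level
at place `r` of the column with index `g` is the level at place `r + a` of the new column with
index `g + b`, where `(a, b)` is this displacement. -/
def Operation.displacement (e : Operation G) (h : ℕ) (k : Fin e.γ) : ℕ × G :=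
  (k * h + e.spacersBelow k, -e.g k)

theorem Operation.displacement_add (e : Operation G) (h h' : ℕ) (k : Fin e.γ) :
    e.displacement (h + h') k = (k : ℕ) • (h, 0) + e.displacement h' k := by
  simp only [displacement, Prod.smul_mk, smul_eq_mul, smul_zero, Prod.mk_add_mk, zero_add, mul_add,
    add_assoc]

variable (F : ℕ → Operation G)

/-- The part of the displacement of the `v`-th piece under the first `L` operations that does not
depend on the height of the columns to which they are applied. The pieces are numbered in the
mixed radix system `(F 0).γ, (F 1).γ, …`, with the digit of the last operation as the leading one;
`Fin.ofNat` does not alter this digit as long as `v < cuts F L`. -/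
def blockDisplacement : ℕ → ℕ → ℕ × G
  | 0, _ => 0
  | L + 1, v => blockDisplacement L (v % cuts F L) +
      (F L).displacement (spacerCount F L) (Fin.ofNat _ (v / cuts F L))

theorem exists_blockDisplacement_add_cuts (L : ℕ) :
    ∃ c : ℕ × G, ∀ x < cuts F L,
      blockDisplacement F (L + 1) (x + cuts F L) = blockDisplacement F (L + 1) x + c := by
  have hzero : (F L).displacement (spacerCount F L) (Fin.ofNat _ 0) = (0, -(F L).g 0) := by
    simp [Operation.displacement, Operation.spacersBelow]
  have hcancel : ((0, -(F L).g 0) + (0, (F L).g 0) : ℕ × G) = 0 := by simp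
  refine ⟨(F L).displacement (spacerCount F L) (Fin.ofNat _ 1) + (0, (F L).g 0), fun x hx => ?_⟩
  rw [blockDisplacement, blockDisplacement, Nat.add_mod_right, Nat.add_div_right _ (cuts_pos F L),
    Nat.div_eq_of_lt hx, hzero, zero_add, add_add_add_comm, hcancel, add_zero]

end Displacement

section Columns

variable {G : Type*} [AddCommGroup G] (F : ℕ → Operation G)

theorem length_column (N : ℕ) (g : G) : (column F N g).length = height F N := by
  induction N generalizing g with
  | zero => rfl
  | succ N ih =>
    simp only [column, List.length_flatMap, List.length_append, List.length_map, ih,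
      List.length_range, height]
    rw [← List.ofFn_eq_map, List.sum_ofFn, Finset.sum_add_distrib, Finset.sum_const,
      Finset.card_fin, smul_eq_mul]

theorem getElem?_column_succ {N : ℕ} {g : G} {r : ℕ} {I : G × ℝ} (hI : (column F N g)[r]? = some I)
    (k : Fin (F N).γ) :
    (column F (N + 1) (g - (F N).g k))[k * height F N + (F N).spacersBelow k + r]? =
      some (piece F N k I) := by
  obtain ⟨hr, -⟩ := List.getElem?_eq_some_iff.1 hI
  set f : Fin (F N).γ → List (G × ℝ) := fun l =>
    (column F N (g - (F N).g k + (F N).g l)).map (piece F N l) ++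
      (List.range ((F N).s l)).map (spacer F N (g - (F N).g k) l)
  have hlength (l : Fin (F N).γ) : (f l).length = height F N + (F N).s l := by
    simp [f, length_column]
  have hbelow : ∑ l with l < k, (f l).length = k * height F N + (F N).spacersBelow k := by
    simp only [hlength, Finset.sum_add_distrib, Finset.sum_const, Finset.filter_gt_eq_Iio,
      Fin.card_Iio, smul_eq_mul, Operation.spacersBelow]
  rw [length_column] at hr
  rw [column, ← hbelow, getElem?_flatMap_finRange f k (by rw [hlength]; omega)]
  simp only [f]
  rw [sub_add_cancel, List.getElem?_append_left (by simpa [length_column] using hr),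
    List.getElem?_map, hI, Option.map_some]

theorem iterate_transformation {N : ℕ} {g : G} {I J x : G × ℝ} {r n : ℕ}
    (hI : (column F N g)[r]? = some I) (hJ : (column F N g)[r + n]? = some J)
    (hx : x ∈ level F N I) : (transformation F)^[n] x = (J.1, x.2 + (J.2 - I.2)) := by
  induction n generalizing J with
  | zero =>
    obtain rfl : I = J := Option.some.inj (hI.symm.trans hJ)
    rw [Function.iterate_zero_apply, sub_self, add_zero, ← show x.1 = I.1 from hx.1]
  | succ n ih =>
    have hlt : r + n < (column F N g).length := by
      have := (List.getElem?_eq_some_iff.1 hJ).1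
      omega
    obtain ⟨K, hK⟩ : ∃ K, (column F N g)[r + n]? = some K := ⟨_, List.getElem?_eq_getElem hlt⟩
    rw [Function.iterate_succ_apply', ih hK]
    refine transformation_eq F ⟨N, g, K, J, pair_isInfix_of_getElem? hK hJ, ?_, ?_⟩
    · obtain ⟨-, hlower, hupper⟩ := hx
      refine ⟨rfl, ?_, ?_⟩ <;> simp only <;> linarith
    · simp only [add_assoc, sub_add_sub_cancel']

end Columns

section Descent

variable {G : Type*} [AddCommGroup G] (F : ℕ → Operation G)

/-- The level at place `r` of any column `g` of generation `N` contains the level at place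
`r + a.1` of the column `g + a.2` of generation `N'`, at a distance `t` from its left end that
depends neither on `r` nor on `g`. -/
def Descends (N N' : ℕ) (a : ℕ × G) : Prop :=
  ∃ t : ℝ, 0 ≤ t ∧ t + width F N' ≤ width F N ∧
    ∀ {g : G} {r : ℕ} {I : G × ℝ}, (column F N g)[r]? = some I →
      (column F N' (g + a.2))[r + a.1]? = some (I.1, I.2 + t)

variable {F}

theorem Descends.refl (N : ℕ) : Descends F N N 0 :=
  ⟨0, le_rfl, by simp, fun hI => by simpa using hI⟩

theorem Descends.trans {N N' N'' : ℕ} {a b : ℕ × G} (h : Descends F N N' a)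
    (h' : Descends F N' N'' b) : Descends F N N'' (a + b) := by
  obtain ⟨t, ht, htw, hcol⟩ := h
  obtain ⟨t', ht', htw', hcol'⟩ := h'
  refine ⟨t + t', add_nonneg ht ht', by linarith, fun hI => ?_⟩
  simpa only [Prod.fst_add, Prod.snd_add, add_assoc] using hcol' (hcol hI)

theorem Descends.of_operation {N : ℕ} {e : Operation G} (h : F N = e) (k : Fin e.γ) :
    Descends F N (N + 1) (e.displacement (height F N) k) := by
  subst h
  have hk : ((k : ℕ) : ℝ) + 1 ≤ (F N).γ := by exact_mod_cast k.2
  have hw := width_pos F (N + 1)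
  refine ⟨k * width F (N + 1), by positivity, ?_, fun {g r I} hI => ?_⟩
  · rw [← width_succ F N, ← add_one_mul]
    gcongr
  · rw [Operation.displacement, ← sub_eq_add_neg, add_comm r]
    exact getElem?_column_succ F hI k

theorem Descends.exists_of_le {N N' : ℕ} (h : N ≤ N') : ∃ a : ℕ × G, Descends F N N' a := by
  induction N', h using Nat.le_induction with
  | base => exact ⟨0, Descends.refl N⟩
  | succ N' _ ih =>
    obtain ⟨a, ha⟩ := ih
    exact ⟨_, ha.trans (Descends.of_operation rfl 0)⟩

theorem PrefixAt.descends {L q v : ℕ} (h : PrefixAt F L q) (hv : v < cuts F L) :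
    Descends F q (q + L) (v • (height F q, 0) + blockDisplacement F L v) := by
  induction L generalizing v with
  | zero =>
    obtain rfl : v = 0 := by simpa [cuts] using hv
    simpa [blockDisplacement] using Descends.refl q
  | succ L ih =>
    set Γ := cuts F L
    have hdigit : v / Γ < (F L).γ := Nat.div_lt_of_lt_mul (by rwa [mul_comm, ← cuts_succ])
    have hdescends := (ih (h.mono L.le_succ) (Nat.mod_lt v (cuts_pos F L))).trans
      (Descends.of_operation (h L L.lt_succ_self) (Fin.ofNat _ (v / Γ)))
    have hheight : (v / Γ) • (Γ * height F q, (0 : G)) = (Γ * (v / Γ)) • (height F q, 0) := by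
      simp only [Prod.smul_mk, smul_eq_mul, smul_zero, mul_left_comm, mul_assoc]
    rw [(h.mono L.le_succ).height_add, Operation.displacement_add, Fin.val_ofNat,
      Nat.mod_eq_of_lt hdigit, hheight, add_add_add_comm, ← add_smul, Nat.mod_add_div] at hdescends
    exact hdescends

theorem exists_descends_sum_blockDisplacement {p L : ℕ} {q : ℕ → ℕ} (hp : p ≤ q 0) (n : ℕ)
    (hprefix : ∀ i < n, PrefixAt F L (q i)) (hq : ∀ i, q i + L ≤ q (i + 1)) :
    ∃ b : ℕ × G, ∀ v : ℕ → ℕ, (∀ i < n, v i < cuts F L) → Descends F p (q n)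
      (b + ∑ i ∈ Finset.range n, (v i • (height F (q i), 0) + blockDisplacement F L (v i))) := by
  induction n with
  | zero =>
    obtain ⟨b, hb⟩ := Descends.exists_of_le (F := F) hp
    exact ⟨b, fun _ _ => by simpa using hb⟩
  | succ n ih =>
    obtain ⟨b, hb⟩ := ih fun i hi => hprefix i (by omega)
    obtain ⟨b', hb'⟩ := Descends.exists_of_le (F := F) (hq n)
    refine ⟨b + b', fun v hv => ?_⟩
    convert ((hb v fun i hi => hv i (by omega)).trans
      ((hprefix n n.lt_succ_self).descends (hv n n.lt_succ_self))).trans hb' using 1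
    rw [Finset.sum_range_succ]
    abel

theorem exists_descends_add_nsmul (d : ℕ) : ∃ c : ℕ × G, ∀ {p : ℕ} {q : ℕ → ℕ}, p ≤ q 0 →
    (∀ i < cuts F d, PrefixAt F (d + 1) (q i)) → (∀ i, q i + (d + 1) ≤ q (i + 1)) →
    ∃ b : ℕ × G, ∀ j ≤ cuts F d, Descends F p (q (cuts F d))
      (b + j • ((∑ i ∈ Finset.range (cuts F d), height F (q i), 0) + c)) := by
  obtain ⟨c, hc⟩ := exists_blockDisplacement_add_cuts F d
  set Γ := cuts F d
  have hcuts : 2 * Γ ≤ cuts F (d + 1) := by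
    rw [cuts_succ]
    exact Nat.mul_le_mul_right _ (F d).one_lt
  refine ⟨c, fun {p q} hp hprefix hq => ?_⟩
  obtain ⟨b, hb⟩ := exists_descends_sum_blockDisplacement hp Γ hprefix hq
  refine ⟨b + ∑ i ∈ Finset.range Γ, (i • (height F (q i), 0) + blockDisplacement F (d + 1) i),
    fun j hj => ?_⟩
  convert hb (fun i => i + j) fun i hi => by omega using 1
  have hsum : (∑ i ∈ Finset.range Γ, height F (q i), (0 : G)) =
      ∑ i ∈ Finset.range Γ, (height F (q i), 0) := by
    ext <;> simp [Prod.fst_sum, Prod.snd_sum]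
  simp only [add_smul, Finset.sum_add_distrib, sum_range_add_of_quasiperiodic hc hj,
    smul_add, hsum, ← Finset.smul_sum]
  abel

theorem Admissible.exists_descends_progression (hF : Admissible F) (d : ℕ) :
    ∃ M, ∀ p, PrefixAt F M p → ∃ n, 0 < n ∧ ∃ a : ℕ × G,
      ∀ j ≤ d, Descends F p (p + M) (a + j • (n, 0)) := by
  obtain ⟨q, hq⟩ := hF.exists_spaced_prefixAt (d + 1)
  obtain ⟨c, hc⟩ := exists_descends_add_nsmul (F := F) d
  set Γ := cuts F d
  have hqmono : StrictMono q := strictMono_nat_of_lt_succ fun i => by have := (hq i).2; omega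
  refine ⟨q (Γ + Γ), fun p hp => ?_⟩
  have hprefix (i : ℕ) (hi : i < Γ + Γ) : PrefixAt F (d + 1) (p + q i) :=
    hp.add (hq i).1 ((hq i).2.trans (hqmono.monotone hi))
  have hgap (i : ℕ) : p + q i + (d + 1) ≤ p + q (i + 1) := by have := (hq i).2; omega
  obtain ⟨b, hb⟩ := hc (p := p) (q := fun i => p + q i) (by omega)
    (fun i hi => hprefix i (by omega)) hgap
  obtain ⟨b', hb'⟩ := hc (p := p + q Γ) (q := fun i => p + q (Γ + i)) le_rfl
    (fun i hi => hprefix (Γ + i) (by omega)) fun i => hgap (Γ + i)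
  set S := ∑ i ∈ Finset.range Γ, height F (p + q i)
  have hlt : S < ∑ i ∈ Finset.range Γ, height F (p + q (Γ + i)) :=
    Finset.sum_lt_sum_of_nonempty (Finset.nonempty_range_iff.2 (cuts_pos F d).ne') fun i _ =>
      height_strictMono F (Nat.add_lt_add_left (hqmono (Nat.lt_add_of_pos_left (cuts_pos F d))) p)
  obtain ⟨n, hn, hSn⟩ := exists_pos_add_of_lt' hlt
  refine ⟨n, hn, b + b' + Γ • ((S, 0) + c), fun j hj => ?_⟩
  have hjΓ : j ≤ Γ := hj.trans (lt_cuts F d).le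
  convert (hb (Γ - j) (Nat.sub_le _ _)).trans (hb' j hjΓ) using 1
  obtain ⟨i, hi⟩ := Nat.exists_eq_add_of_le hjΓ
  have hS : (S + n, (0 : G)) = (S, 0) + (n, 0) := by simp
  rw [← hSn, hS, hi, Nat.add_sub_cancel_left]
  simp only [smul_add, add_smul]
  abel

end Descent

section Width

variable {G : Type*} {F : ℕ → Operation G}

theorem PrefixAt.width_add {M p : ℕ} (h : PrefixAt F M p) :
    width F (p + M) = width F p * width F M := by
  simp only [width, Finset.prod_range_add]
  congr 1
  exact Finset.prod_congr rfl fun l hl => by rw [h l (Finset.mem_range.1 hl)]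

theorem tendsto_width (F : ℕ → Operation G) : Tendsto (width F) atTop (𝓝[>] 0) := by
  have hwidth : width F = fun N => (cuts F N : ℝ)⁻¹ := by
    ext N
    simp only [width, cuts, Nat.cast_prod, Finset.prod_inv_distrib]
  rw [hwidth]
  exact tendsto_inv_atTop_nhdsGT_zero.comp (tendsto_natCast_atTop_atTop.comp
    (tendsto_atTop_mono (fun N => (lt_cuts F N).le) tendsto_id))

end Width

section Space

variable {G : Type*} [AddCommGroup G] (F : ℕ → Operation G)

theorem exists_level_of_le {N N' : ℕ} (h : N ≤ N') {g : G} {I x : G × ℝ} (hI : I ∈ column F N g)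
    (hx : x ∈ level F N I) : ∃ g', ∃ I' ∈ column F N' g', x ∈ level F N' I' := by
  induction N', h using Nat.le_induction with
  | base => exact ⟨g, I, hI, hx⟩
  | succ N' _ ih =>
    obtain ⟨g', I', hI', hx'⟩ := ih
    obtain ⟨k, hk⟩ := exists_piece F N' I' x hx'
    exact ⟨g' - (F N').g k, _, (mem_column_succ F).2 ⟨k, Or.inl ⟨I', by rwa [sub_add_cancel], rfl⟩⟩,
      hk⟩

theorem mem_space {x : G × ℝ} :
    x ∈ space F ↔ ∃ N g, ∃ I ∈ column F N g, x ∈ level F N I := by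
  simp only [space, Set.mem_iUnion, exists_prop]

theorem column_add (N : ℕ) (g h : G) :
    column F N (g + h) = (column F N g).map fun I => (I.1 + h, I.2) := by
  induction N generalizing g with
  | zero => rfl
  | succ N ih =>
    simp only [column, List.map_flatMap, List.map_append, List.map_map, add_right_comm g h, ih]
    rfl

theorem space_eq_univ_prod :
    space F = Set.univ ×ˢ ⋃ N, ⋃ I ∈ column F N 0, Set.Ico I.2 (I.2 + width F N) := by
  ext ⟨a, t⟩
  simp only [mem_space, Set.mem_prod, Set.mem_univ, true_and, Set.mem_iUnion, exists_prop]
  constructor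
  · rintro ⟨N, g, I, hI, -, ht⟩
    rw [← zero_add g, column_add, List.mem_map] at hI
    obtain ⟨I₀, hI₀, rfl⟩ := hI
    exact ⟨N, I₀, hI₀, ht⟩
  · rintro ⟨N, I, hI, ht⟩
    refine ⟨N, 0 + (a - I.1), (a, I.2), ?_, rfl, ht⟩
    rw [column_add]
    exact List.mem_map.2 ⟨I, hI, by simp⟩

variable [MeasurableSpace G]

theorem measurableSet_space : MeasurableSet (space F) := by
  rw [space_eq_univ_prod]
  refine MeasurableSet.univ.prod (MeasurableSet.iUnion fun N => ?_)
  exact MeasurableSet.biUnion (List.finite_toSet _).countable fun _ _ => measurableSet_Ico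

theorem measure_univ_eq_top [Infinite G] : measure F Set.univ = ⊤ := by
  have hsub : (Set.univ : Set G) ×ˢ Set.Ico (0 : ℝ) 1 ⊆ space F := fun x hx =>
    (mem_space F).2 ⟨0, x.1, (x.1, 0), List.mem_singleton_self _, rfl, by simpa [width] using hx.2⟩
  rw [measure, Measure.restrict_apply_univ, eq_top_iff]
  refine le_of_eq_of_le ?_ (measure_mono hsub)
  rw [Measure.prod_prod, Measure.count_apply_infinite Set.infinite_univ, Real.volume_Ico, sub_zero,
    ENNReal.ofReal_one, mul_one]

theorem measure_singleton_prod [MeasurableSingletonClass G] {a : G} {E : Set ℝ}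
    (h : {a} ×ˢ E ⊆ space F) : measure F ({a} ×ˢ E) = volume E := by
  rw [measure, Measure.restrict_eq_self _ h, Measure.prod_prod, Measure.count_singleton, one_mul]

theorem exists_volume_fiber_ne_zero {A : Set (G × ℝ)} (hA : MeasurableSet A)
    (hpos : 0 < measure F A) : ∃ a, volume (Prod.mk a ⁻¹' (A ∩ space F)) ≠ 0 := by
  by_contra! hnull
  rw [measure, Measure.restrict_apply hA] at hpos
  exact hpos.ne' (Measure.measure_prod_null_of_ae_null (hA.inter (measurableSet_space F))
    (Eventually.of_forall hnull))

end Space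

section MultipleRecurrence

variable {G : Type*} [AddCommGroup G] {F : ℕ → Operation G}

theorem eventually_exists_dense_level [MeasurableSpace G] {A : Set (G × ℝ)} (hA : MeasurableSet A)
    (hpos : 0 < measure F A) {ε : ℝ≥0∞} (hε : ε ≠ 0) :
    ∀ᶠ N in atTop, ∃ g, ∃ I ∈ column F N g,
      volume (Set.Ico I.2 (I.2 + width F N) \ Prod.mk I.1 ⁻¹' A) <
        ε * ENNReal.ofReal (width F N) := by
  obtain ⟨a, ha⟩ := exists_volume_fiber_ne_zero F hA hpos
  have hfiber : MeasurableSet (Prod.mk a ⁻¹' (A ∩ space F)) :=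
    measurable_prodMk_left (hA.inter (measurableSet_space F))
  obtain ⟨t, ht, hdense⟩ := ((frequently_ae_mem_iff.2 ha).and_eventually
    (ae_eventually_volume_Ico_diff_lt hfiber hε)).exists
  obtain ⟨N₀, g₀, I₀, hI₀, ht₀⟩ := (mem_space F).1 ht.2
  filter_upwards [(tendsto_width F).eventually (hdense ht), eventually_ge_atTop N₀] with N hN hle
  obtain ⟨g, I, hI, ha, htI⟩ := exists_level_of_le F hle hI₀ ht₀
  obtain rfl : a = I.1 := ha
  refine ⟨g, I, hI, (measure_mono ?_).trans_lt (hN I.2 htI)⟩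
  exact Set.sdiff_subset_sdiff_right (Set.preimage_mono Set.inter_subset_left)

theorem prod_subset_iInter_image_iterate {N d n r : ℕ} {g a : G} {b : ℕ → ℝ} (A : Set (G × ℝ))
    (hcolumn : ∀ j ≤ d, (column F N g)[r + j * n]? = some (a, b j)) :
    {a} ×ˢ {s ∈ Set.Ico (b d) (b d + width F N) |
        ∀ j ∈ Finset.range (d + 1), s + (b j - b d) ∈ Prod.mk a ⁻¹' A} ⊆
      ⋂ j ∈ Finset.range (d + 1), (transformation F)^[j * n] '' A := by
  rintro ⟨a', s⟩ ⟨ha, ⟨hlower, hupper⟩, hA⟩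
  obtain rfl : a' = a := ha
  simp only at hlower hupper hA
  refine Set.mem_iInter₂.2 fun j hj => ?_
  have hjd : j ≤ d := Finset.mem_range_succ_iff.1 hj
  have htop : r + (d - j) * n + j * n = r + d * n := by
    rw [add_assoc, ← add_mul, Nat.sub_add_cancel hjd]
  refine ⟨(a', s + (b (d - j) - b d)), hA (d - j) (Finset.mem_range.2 (by omega)), ?_⟩
  have hmem : (a', s + (b (d - j) - b d)) ∈ level F N (a', b (d - j)) :=
    ⟨rfl, by simp only; linarith, by simp only; linarith⟩
  rw [iterate_transformation F (hcolumn (d - j) (Nat.sub_le d j)) (htop ▸ hcolumn d le_rfl) hmem]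
  simp only [add_assoc, sub_add_sub_cancel', sub_self, add_zero]

theorem Admissible.isRecurrent [MeasurableSpace G] [MeasurableSingletonClass G]
    (hF : Admissible F) (d : ℕ) : IsRecurrent (measure F) (transformation F) d := by
  intro A hA hpos
  obtain ⟨M, hM⟩ := hF.exists_descends_progression d
  have hε : ENNReal.ofReal (width F M) / (d + 1 : ℕ) ≠ 0 :=
    ENNReal.div_ne_zero.2 ⟨by simpa using width_pos F M, ENNReal.natCast_ne_top _⟩
  obtain ⟨p, hp, g, I, hI, hdense⟩ := ((hF.frequently_prefixAt M).and_eventually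
    (eventually_exists_dense_level hA hpos hε)).exists
  obtain ⟨n, hn, a, hprogression⟩ := hM p hp
  obtain ⟨r, hr⟩ := List.mem_iff_getElem?.1 hI
  choose! t ht0 htw ht using hprogression
  have hcolumn : ∀ j ≤ d,
      (column F (p + M) (g + a.2))[r + a.1 + j * n]? = some (I.1, I.2 + t j) := fun j hj => by
    simpa [add_assoc] using ht j hj hr
  refine ⟨n, hn, LT.lt.trans_le ?_
    (measure_mono (prod_subset_iInter_image_iterate A hcolumn))⟩
  rw [measure_singleton_prod F fun x hx => (mem_space F).2
    ⟨_, _, _, List.mem_of_getElem? (hcolumn d le_rfl), hx.1, hx.2.1⟩]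
  refine measure_setOf_forall_add_mem_pos volume (K := Set.Ico I.2 (I.2 + width F p))
    (fun j hj s hs => ?_) ?_
  · have hjd : j ≤ d := Finset.mem_range_succ_iff.1 hj
    constructor <;> linarith [hs.1, hs.2, ht0 j hjd, htw j hjd]
  · rw [Finset.card_range, Real.volume_Ico, add_sub_cancel_left, hp.width_add, nsmul_eq_mul,
      ENNReal.ofReal_mul (width_pos F p).le]
    have hd : ((d + 1 : ℕ) : ℝ≥0∞) ≠ 0 := Nat.cast_ne_zero.2 d.succ_ne_zero
    refine ((ENNReal.mul_lt_mul_iff_right hd (ENNReal.natCast_ne_top _)).2 hdense).trans_eq ?_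
    rw [← mul_assoc, ENNReal.mul_div_cancel hd (ENNReal.natCast_ne_top _), mul_comm]

end MultipleRecurrence

end CutStack

theorem mainTheorem2_general {G : Type*} [AddCommGroup G] [MeasurableSpace G]
    [MeasurableSingletonClass G] (F : ℕ → CutStack.Operation G) (hF : CutStack.Admissible F) :
    CutStack.MultiplyRecurrent (CutStack.measure F) (CutStack.transformation F) ∧
      (Infinite G → CutStack.measure F Set.univ = ⊤) :=
  ⟨fun d _ => hF.isRecurrent d, fun _ => CutStack.measure_univ_eq_top F⟩

/-- For every countable discrete abelian group `G` and every admissible sequence of operations, the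
resulting transformation is multiply recurrent; if `G` is infinite, the measure is infinite. -/
theorem mainTheorem2 {G : Type*} [AddCommGroup G] [Countable G] [MeasurableSpace G]
    [DiscreteMeasurableSpace G] (F : ℕ → CutStack.Operation G) (hF : CutStack.Admissible F) :
    CutStack.MultiplyRecurrent (CutStack.measure F) (CutStack.transformation F) ∧
      (Infinite G → CutStack.measure F Set.univ = ⊤) :=
  mainTheorem2_general F hF
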